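/- Let $H_1,H_2$ be complex Hilbert spaces and let $T:D(T)\subseteq H_1\to H_2$ be a densely defined closed linear operator with adjoint $T^*$. For a densely defined closed operator $A:D(A)\subseteq H\to K$ between complex Hilbert spaces put $m(A):=\inf\{\|Ax\| : x\in D(A),\ \|x\|=1\}$, and call $A$ *minimum attaining* if there is $x_0\in D(A)$ with $\|x_0\|=1$ and $\|Ax_0\|=m(A)$. Let $T^*T$ be the operator $x\mapsto T^*(Tx)$ with domain $\{x\in D(T) : Tx\in D(T^*)\}$, and let $|T|:=(T^*T)^{1/2}$, that is, the unique positive operator $S$ in $H_1$ (meaning densely defined, $S=S^*$ and $\langle Sx,x\rangle\ge 0$ for all $x\in D(S)$) such that $S^2=T^*T$, where $S^2$ has domain $\{x\in D(S):Sx\in D(S)\}$. Then the following are equivalent: 1. $T$ is minimum attaining; 2. $|T|$ is minimum attaining; 3. $T^*T$ is minimum attaining. (In 2 and 3, being minimum attaining includes that the operator is densely defined and closed.) -/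

import Mathlib

open scoped LinearPMap

namespace UnboundedOperator

noncomputable section

/-- The product `R T` of two partially defined operators, with its natural domain
`D(RT) = {x ∈ D(T) : T x ∈ D(R)}`. -/
def prod {E F G : Type*}
    [AddCommGroup E] [Module ℂ E] [AddCommGroup F] [Module ℂ F] [AddCommGroup G] [Module ℂ G]
    (R : F →ₗ.[ℂ] G) (T : E →ₗ.[ℂ] F) : E →ₗ.[ℂ] G where
  domain := (R.domain.comap T.toFun).map T.domain.subtype
  toFun := R.toFun ∘ₗ
    (T.toFun ∘ₗ Submodule.inclusion (Submodule.map_subtype_le T.domain _)).codRestrict R.domain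
      (by
        rintro ⟨x, y, hy, rfl⟩
        exact hy)

theorem mem_prod_domain {E F G : Type*}
    [AddCommGroup E] [Module ℂ E] [AddCommGroup F] [Module ℂ F] [AddCommGroup G] [Module ℂ G]
    (R : F →ₗ.[ℂ] G) (T : E →ₗ.[ℂ] F) (x : E) :
    x ∈ (prod R T).domain ↔ ∃ hx : x ∈ T.domain, T ⟨x, hx⟩ ∈ R.domain := by
  constructor
  · rintro ⟨y, hy, rfl⟩
    exact ⟨y.2, hy⟩
  · rintro ⟨hx, h⟩
    exact ⟨⟨x, hx⟩, h, rfl⟩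

theorem prod_apply {E F G : Type*}
    [AddCommGroup E] [Module ℂ E] [AddCommGroup F] [Module ℂ F] [AddCommGroup G] [Module ℂ G]
    (R : F →ₗ.[ℂ] G) (T : E →ₗ.[ℂ] F) (x : E) (hx : x ∈ T.domain)
    (h : T ⟨x, hx⟩ ∈ R.domain) (hx' : x ∈ (prod R T).domain) :
    prod R T ⟨x, hx'⟩ = R ⟨T ⟨x, hx⟩, h⟩ := rfl

/-- The minimum modulus `m(T) = inf {‖T x‖ : x ∈ D(T), ‖x‖ = 1}`. -/
def minModulus {E F : Type*} [NormedAddCommGroup E] [InnerProductSpace ℂ E]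
    [NormedAddCommGroup F] [InnerProductSpace ℂ F] (T : E →ₗ.[ℂ] F) : ℝ :=
  sInf {r : ℝ | ∃ x : T.domain, ‖(x : E)‖ = 1 ∧ r = ‖T x‖}

/-- `T` is a minimum attaining operator: a densely defined closed operator for which there is a
unit vector `x₀ ∈ D(T)` with `‖T x₀‖ = m(T)`. -/
structure IsMinimumAttaining {E F : Type*} [NormedAddCommGroup E] [InnerProductSpace ℂ E]
    [NormedAddCommGroup F] [InnerProductSpace ℂ F] (T : E →ₗ.[ℂ] F) : Prop where
  dense_domain : Dense (T.domain : Set E)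
  isClosed : T.IsClosed
  attains : ∃ x₀ : T.domain, ‖(x₀ : E)‖ = 1 ∧ ‖T x₀‖ = minModulus T

/-- A positive (possibly unbounded) operator: `A = A*` and `⟨A x, x⟩ ≥ 0` for all `x ∈ D(A)`.
Self-adjointness in Mathlib's sense includes density of the domain and implies closedness, and it
makes `⟨A x, x⟩` real. -/
structure IsPositive {E : Type*} [NormedAddCommGroup E] [InnerProductSpace ℂ E] [CompleteSpace E]
    (A : E →ₗ.[ℂ] E) : Prop where
  isSelfAdjoint : IsSelfAdjoint A
  nonneg : ∀ x : A.domain, 0 ≤ (inner ℂ (A x) (x : E)).re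

open Classical in
/-- The square root `A^{1/2}` of a positive operator `A`: the (unique) positive operator `S` with
`S S = A`, domains included. If there is no such operator (so `A` is not positive), the value is
the operator with domain `{0}`. -/
def sqrt {E : Type*} [NormedAddCommGroup E] [InnerProductSpace ℂ E] [CompleteSpace E]
    (A : E →ₗ.[ℂ] E) : E →ₗ.[ℂ] E :=
  if h : ∃ S : E →ₗ.[ℂ] E, IsPositive S ∧ prod S S = A then h.choose else ⊥

/-- The modulus `|T| = (T* T)^{1/2}`. -/
def modulus {E F : Type*} [NormedAddCommGroup E] [InnerProductSpace ℂ E] [CompleteSpace E]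
    [NormedAddCommGroup F] [InnerProductSpace ℂ F] (T : E →ₗ.[ℂ] F) : E →ₗ.[ℂ] E :=
  sqrt (prod T† T)

end

end UnboundedOperator

namespace UnboundedOperator

/-! ### Graphs of products and adjoints -/

section Graph

/-! Everything reduces to 1 ↔ 3 for an arbitrary closed densely defined operator
(`isMinimumAttaining_iff_adjoint_prod_self`). Applied to S = |T|, where S*S = S² = T*T, the same
equivalence gives 2 ↔ 3.

1 → 3: by first variation a minimizer x₀ satisfies T*T x₀ = m² x₀ with m = m(T), and ‖Tx‖² = ⟨T*Tx,
x⟩ ≤ ‖T*Tx‖‖x‖ shows that no unit vector does better than m². 3 → 1: a minimizer of the positive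
operator A = T*T is an eigenvector, A x₀ = c x₀ with c = m(A), so ‖Tx₀‖² = c; and c‖x‖ ≤ ‖Ax‖ on
D(A) implies c‖x‖² ≤ ‖Tx‖² on D(T) (`bounded_below_of_adjoint_prod_self`).

|T| is built without the spectral theorem for unbounded operators: with B = (1 + T*T)⁻¹, it is (1 -
B)^{1/2} B^{-1/2}. -/

theorem mem_graph_prod {E F G : Type*}
    [AddCommGroup E] [Module ℂ E] [AddCommGroup F] [Module ℂ F] [AddCommGroup G] [Module ℂ G]
    {R : F →ₗ.[ℂ] G} {T : E →ₗ.[ℂ] F} {x : E} {z : G} :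
    (x, z) ∈ (prod R T).graph ↔ ∃ y, (x, y) ∈ T.graph ∧ (y, z) ∈ R.graph := by
  simp only [LinearPMap.mem_graph_iff]
  constructor
  · rintro ⟨⟨u, hu⟩, rfl, rfl⟩
    obtain ⟨hx, h⟩ := (mem_prod_domain R T u).1 hu
    exact ⟨T ⟨u, hx⟩, ⟨⟨u, hx⟩, rfl, rfl⟩, ⟨⟨_, h⟩, rfl, (prod_apply R T u hx h hu).symm⟩⟩
  · rintro ⟨y, ⟨⟨u, hu⟩, rfl, rfl⟩, ⟨⟨v, hv⟩, hvu, rfl⟩⟩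
    dsimp only at hvu
    subst hvu
    have hm := (mem_prod_domain R T u).2 ⟨hu, hv⟩
    exact ⟨⟨u, hm⟩, rfl, prod_apply R T u hu hv hm⟩

variable {E F : Type*} [NormedAddCommGroup E] [InnerProductSpace ℂ E]
  [NormedAddCommGroup F] [InnerProductSpace ℂ F]

theorem mem_graph_adjoint [CompleteSpace E] {T : E →ₗ.[ℂ] F} (hT : Dense (T.domain : Set E))
    {y : F} {w : E} :
    (y, w) ∈ T†.graph ↔ ∀ x z, (x, z) ∈ T.graph → inner ℂ w x = inner ℂ y z := by
  rw [LinearPMap.adjoint_graph_eq_graph_adjoint hT, Submodule.mem_adjoint_iff]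
  refine forall₃_congr fun x z _ => ?_
  rw [sub_eq_zero, ← inner_conj_symm w x, ← inner_conj_symm y z]
  exact ⟨fun h => by rw [h], fun h => ((starRingEnd ℂ).injective h).symm⟩

/-- Rescaling to the unit sphere turns the infimum into a homogeneous inequality on the graph, the
form used throughout. -/
theorem attains_iff {T : E →ₗ.[ℂ] F} :
    (∃ x₀ : T.domain, ‖(x₀ : E)‖ = 1 ∧ ‖T x₀‖ = minModulus T) ↔
      ∃ x₀ y₀, (x₀, y₀) ∈ T.graph ∧ ‖x₀‖ = 1 ∧
        ∀ x y, (x, y) ∈ T.graph → ‖y₀‖ * ‖x‖ ≤ ‖y‖ := by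
  constructor
  · rintro ⟨x₀, h1, h2⟩
    refine ⟨x₀, T x₀, T.mem_graph x₀, h1, fun x y hxy => ?_⟩
    obtain ⟨u, rfl, rfl⟩ := T.mem_graph_iff.1 hxy
    rcases eq_or_ne (u : E) 0 with h0 | h0
    · simp [h0]
    have hpos : 0 < ‖(u : E)‖ := norm_pos_iff.2 h0
    have hn : ‖(((‖(u : E)‖⁻¹ : ℝ) : ℂ))‖ = ‖(u : E)‖⁻¹ := by
      rw [Complex.norm_real, norm_inv, norm_norm]
    have hle : minModulus T ≤ ‖T (((‖(u : E)‖⁻¹ : ℝ) : ℂ) • u)‖ := by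
      refine csInf_le ⟨0, ?_⟩ ⟨_, ?_, rfl⟩
      · rintro _ ⟨_, _, rfl⟩
        exact norm_nonneg _
      · rw [Submodule.coe_smul, norm_smul, hn, inv_mul_cancel₀ hpos.ne']
    rw [LinearPMap.map_smul, norm_smul, hn, ← h2, inv_mul_eq_div, le_div_iff₀ hpos] at hle
    exact hle
  · rintro ⟨x, y, hxy, h1, h2⟩
    obtain ⟨u, rfl, rfl⟩ := T.mem_graph_iff.1 hxy
    refine ⟨u, h1, le_antisymm (le_csInf ⟨_, u, h1, rfl⟩ ?_) (csInf_le ⟨0, ?_⟩ ⟨u, h1, rfl⟩)⟩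
    · rintro _ ⟨v, hv, rfl⟩
      simpa [hv] using h2 v (T v) (T.mem_graph v)
    · rintro _ ⟨_, _, rfl⟩
      exact norm_nonneg _

end Graph

/-! ### Von Neumann's theorem: T*T is positive and self-adjoint -/

section VonNeumann

variable {E F : Type*} [NormedAddCommGroup E] [InnerProductSpace ℂ E] [CompleteSpace E]
  [NormedAddCommGroup F] [InnerProductSpace ℂ F] {T : E →ₗ.[ℂ] F}

theorem inner_adjoint_prod_self (hT : Dense (T.domain : Set E)) {x y u : E} {t s : F}
    (hxy : (x, y) ∈ (prod T† T).graph) (hxt : (x, t) ∈ T.graph) (hus : (u, s) ∈ T.graph) :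
    inner ℂ y u = inner ℂ t s := by
  obtain ⟨t', ht', hy⟩ := mem_graph_prod.1 hxy
  obtain rfl : t' = t := T.mem_graph_snd_inj ht' hxt rfl
  exact (mem_graph_adjoint hT).1 hy u s hus

theorem adjoint_prod_self_symmetric (hT : Dense (T.domain : Set E)) {x y u v : E}
    (hxy : (x, y) ∈ (prod T† T).graph) (huv : (u, v) ∈ (prod T† T).graph) :
    inner ℂ y u = inner ℂ x v := by
  obtain ⟨t, ht, -⟩ := mem_graph_prod.1 hxy
  obtain ⟨s, hs, -⟩ := mem_graph_prod.1 huv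
  rw [inner_adjoint_prod_self hT hxy ht hs, ← inner_conj_symm x v,
    inner_adjoint_prod_self hT huv hs ht, inner_conj_symm]

theorem re_inner_adjoint_prod_self_nonneg (hT : Dense (T.domain : Set E)) {x y : E}
    (hxy : (x, y) ∈ (prod T† T).graph) : 0 ≤ (inner ℂ y x).re := by
  obtain ⟨t, ht, -⟩ := mem_graph_prod.1 hxy
  rw [inner_adjoint_prod_self hT hxy ht ht]
  exact inner_self_nonneg (𝕜 := ℂ)

/-- The bounded operator `(1 + T* T)⁻¹`, obtained from the orthogonal projection onto the graph
of `T`. -/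
theorem exists_one_add_adjoint_prod_self_inverse [CompleteSpace F]
    (hT : Dense (T.domain : Set E)) (hc : T.IsClosed) :
    ∃ B : E →L[ℂ] E, ∀ h, (B h, h - B h) ∈ (prod T† T).graph := by
  let e := WithLp.prodContinuousLinearEquiv 2 ℂ E F
  let K : Submodule ℂ (WithLp 2 (E × F)) := T.graph.comap (e : WithLp 2 (E × F) →ₗ[ℂ] E × F)
  have hK : IsClosed (K : Set (WithLp 2 (E × F))) := hc.preimage e.continuous
  have : CompleteSpace K := hK.completeSpace_coe
  let B : E →L[ℂ] E := ContinuousLinearMap.fst ℂ E F ∘L (e : WithLp 2 (E × F) →L[ℂ] E × F) ∘L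
    K.starProjection ∘L (e.symm : E × F →L[ℂ] WithLp 2 (E × F)) ∘L ContinuousLinearMap.inl ℂ E F
  refine ⟨B, fun h => ?_⟩
  -- The residual (h - p₁, -p₂) is orthogonal to the graph of T, which says exactly T* p₂ = h - p₁.
  set p := K.starProjection (e.symm (h, 0)) with hp
  have hpK : (p.fst, p.snd) ∈ T.graph := K.starProjection_apply_mem _
  have hB : B h = p.fst := rfl
  rw [hB, mem_graph_prod]
  refine ⟨p.snd, hpK, (mem_graph_adjoint hT).2 fun x z hxz => ?_⟩
  have hq : (e.symm (x, z)) ∈ K := hxz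
  have := K.starProjection_inner_eq_zero (e.symm (h, 0)) _ hq
  rw [WithLp.prod_inner_apply] at this
  change inner ℂ (h - p.fst) x + inner ℂ (0 - p.snd) z = 0 at this
  rw [zero_sub, inner_neg_left] at this
  linear_combination this

/-- If y is orthogonal to the domain, then ⟨By, y⟩ = 0, and positivity of T*T at By gives -‖By‖² ≥
0. So By = 0, and (0, y) in the graph forces y = 0. -/
theorem dense_adjoint_prod_self_domain [CompleteSpace F]
    (hT : Dense (T.domain : Set E)) (hc : T.IsClosed) :
    Dense ((prod T† T).domain : Set E) := by
  obtain ⟨B, hB⟩ := exists_one_add_adjoint_prod_self_inverse hT hc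
  rw [Submodule.dense_iff_topologicalClosure_eq_top, Submodule.topologicalClosure_eq_top_iff,
    Submodule.eq_bot_iff]
  intro y hy
  have h0 : inner ℂ (B y) y = 0 :=
    (Submodule.mem_orthogonal _ _).1 hy _ (LinearPMap.mem_domain_of_mem_graph (hB y))
  have h1 := re_inner_adjoint_prod_self_nonneg hT (hB y)
  rw [inner_sub_left, ← inner_conj_symm, h0, map_zero, zero_sub, Complex.neg_re] at h1
  have h2 : B y = 0 := by
    rw [← norm_eq_zero, ← sq_eq_zero_iff]
    have h3 : ‖B y‖ ^ 2 = (inner ℂ (B y) (B y)).re := norm_sq_eq_re_inner (𝕜 := ℂ) _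
    nlinarith [sq_nonneg ‖B y‖]
  have := hB y
  rw [h2, sub_zero] at this
  exact LinearPMap.graph_fst_eq_zero_snd _ this rfl

theorem isPositive_adjoint_prod_self [CompleteSpace F]
    (hT : Dense (T.domain : Set E)) (hc : T.IsClosed) : IsPositive (prod T† T) := by
  have hd := dense_adjoint_prod_self_domain hT hc
  obtain ⟨B, hB⟩ := exists_one_add_adjoint_prod_self_inverse hT hc
  refine ⟨LinearPMap.isSelfAdjoint_def.2 (LinearPMap.eq_of_eq_graph ?_),
    fun x => re_inner_adjoint_prod_self_nonneg hT (LinearPMap.mem_graph _ x)⟩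
  ext ⟨y, w⟩
  rw [mem_graph_adjoint hd]
  refine ⟨fun h => ?_, fun h x z hxz => adjoint_prod_self_symmetric hT h hxz⟩
  -- Every k equals (1 + T*T)(Bk), so testing on the graph points of Bk tests against all of E.
  have hyx : y = B (y + w) := by
    refine ext_inner_right ℂ fun k => ?_
    have h1 := h _ _ (hB k)
    have h2 := adjoint_prod_self_symmetric hT (hB (y + w)) (hB k)
    simp only [inner_sub_left, inner_sub_right, inner_add_left] at h1 h2
    linear_combination h2 - h1
  have := hB (y + w)
  rwa [← hyx, add_sub_cancel_left] at this

end VonNeumann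

end UnboundedOperator

namespace UnboundedOperator

/-! ### Construction of the square root of T*T -/

section SquareRoot

variable {E : Type*} [NormedAddCommGroup E] [InnerProductSpace ℂ E]

/-- The operator `Q R⁻¹` with domain the range of the injective operator `R`. -/
noncomputable def divide (Q R : E →L[ℂ] E) (hR : Function.Injective R) : E →ₗ.[ℂ] E where
  domain := LinearMap.range (R : E →ₗ[ℂ] E)
  toFun := (Q : E →ₗ[ℂ] E) ∘ₗ (LinearEquiv.ofInjective (R : E →ₗ[ℂ] E) hR).symm

theorem mem_graph_divide {Q R : E →L[ℂ] E} {hR : Function.Injective R} {x y : E} :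
    (x, y) ∈ (divide Q R hR).graph ↔ ∃ u, R u = x ∧ Q u = y := by
  rw [LinearPMap.mem_graph_iff]
  have key : ∀ u, (divide Q R hR) ⟨R u, u, rfl⟩ = Q u := fun u =>
    congrArg Q ((LinearEquiv.ofInjective (R : E →ₗ[ℂ] E) hR).symm_apply_apply u)
  constructor
  · rintro ⟨⟨_, u, rfl⟩, rfl, rfl⟩
    exact ⟨u, rfl, (key u).symm⟩
  · rintro ⟨u, rfl, rfl⟩
    exact ⟨⟨R u, u, rfl⟩, rfl, key u⟩

/-- For R² = B the right side reads x = B(x + y), that is, y = (B⁻¹ - 1)x. -/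
theorem mem_graph_divide_prod_self {Q R : E →L[ℂ] E} {hR : Function.Injective R}
    (hRQ : Commute R Q) (hsum : R * R + Q * Q = 1) {x y : E} :
    (x, y) ∈ (prod (divide Q R hR) (divide Q R hR)).graph ↔ R (R (x + y)) = x := by
  have hsum' : ∀ x, R (R x) + Q (Q x) = x := fun x => DFunLike.congr_fun hsum x
  have hRQ' : ∀ x, R (Q x) = Q (R x) := fun x => DFunLike.congr_fun hRQ.eq x
  simp only [mem_graph_prod, mem_graph_divide]
  constructor
  · rintro ⟨_, ⟨u, rfl, rfl⟩, v, hv, rfl⟩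
    rw [map_add, hRQ' v, hv, hsum']
  · intro h
    refine ⟨Q (R (x + y)), ⟨R (x + y), h, rfl⟩, Q (x + y), hRQ' _, ?_⟩
    have := hsum' (x + y)
    rw [h] at this
    exact add_left_cancel this

variable [CompleteSpace E]

theorem dense_divide_domain {Q R : E →L[ℂ] E} {hR : Function.Injective R} (hRs : IsSelfAdjoint R) :
    Dense ((divide Q R hR).domain : Set E) := by
  rw [Submodule.dense_iff_topologicalClosure_eq_top, Submodule.topologicalClosure_eq_top_iff,
    Submodule.eq_bot_iff]
  intro y hy
  apply hR
  rw [map_zero]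
  refine ext_inner_right ℂ fun k => ?_
  have hRy : inner ℂ (R y) k = inner ℂ y (R k) := hRs.isSymmetric y k
  rw [hRy, inner_zero_left]
  exact (Submodule.mem_orthogonal' _ _).1 hy _ ⟨k, rfl⟩

theorem isPositive_divide {Q R : E →L[ℂ] E} {hR : Function.Injective R}
    (hR0 : 0 ≤ R) (hQ0 : 0 ≤ Q) (hRQ : Commute R Q) (hsum : R * R + Q * Q = 1) :
    IsPositive (divide Q R hR) := by
  have hRs : IsSelfAdjoint R := .of_nonneg hR0
  have hQs : IsSelfAdjoint Q := .of_nonneg hQ0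
  have hsum' : ∀ x, R (R x) + Q (Q x) = x := fun x => DFunLike.congr_fun hsum x
  have hRQ' : ∀ x, R (Q x) = Q (R x) := fun x => DFunLike.congr_fun hRQ.eq x
  refine ⟨LinearPMap.isSelfAdjoint_def.2 (LinearPMap.eq_of_eq_graph ?_), fun x => ?_⟩
  · ext ⟨y, w⟩
    rw [mem_graph_adjoint (dense_divide_domain hRs), mem_graph_divide]
    constructor
    · intro h
      have hw : R w = Q y := by
        refine ext_inner_right ℂ fun k => ?_
        exact (hRs.isSymmetric w k).trans ((h _ _ (mem_graph_divide.2 ⟨k, rfl, rfl⟩)).trans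
          (hQs.isSymmetric y k).symm)
      -- If y = Ru and w = Qu, then u = R²u + Q²u = Ry + Qw.
      refine ⟨R y + Q w, ?_, ?_⟩
      · rw [map_add, hRQ', hw, hsum']
      · rw [map_add, ← hRQ', ← hw, hsum']
    · rintro ⟨u, rfl, rfl⟩ x z hxz
      obtain ⟨v, rfl, rfl⟩ := mem_graph_divide.1 hxz
      have h1 := hQs.isSymmetric u (R v)
      have h2 := hRs.isSymmetric u (Q v)
      exact (h1.trans (by rw [ContinuousLinearMap.coe_coe, ← hRQ']; rfl)).trans h2.symm
  · obtain ⟨u, hu, hy⟩ := mem_graph_divide.1 (LinearPMap.mem_graph _ x)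
    rw [← hu, ← hy]
    have h1 := hRs.isSymmetric (Q u) u
    have h2 := (ContinuousLinearMap.nonneg_iff_isPositive _).1 (hRQ.mul_nonneg hR0 hQ0)
    have h3 := h2.re_inner_nonneg_left u
    exact (congrArg Complex.re h1).symm ▸ h3

variable {F : Type*} [NormedAddCommGroup F] [InnerProductSpace ℂ F] [CompleteSpace F]

theorem exists_sqrt_adjoint_prod_self {T : E →ₗ.[ℂ] F}
    (hT : Dense (T.domain : Set E)) (hc : T.IsClosed) :
    ∃ S : E →ₗ.[ℂ] E, IsPositive S ∧ prod S S = prod T† T := by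
  obtain ⟨B, hB⟩ := exists_one_add_adjoint_prod_self_inverse hT hc
  have hBs : IsSelfAdjoint B := by
    rw [ContinuousLinearMap.isSelfAdjoint_iff_isSymmetric]
    intro x y
    have := adjoint_prod_self_symmetric hT (hB x) (hB y)
    simp only [inner_sub_left, inner_sub_right] at this
    simp only [ContinuousLinearMap.coe_coe]
    linear_combination -this
  have hB0 : 0 ≤ B := by
    rw [ContinuousLinearMap.nonneg_iff_isPositive, ContinuousLinearMap.isPositive_def']
    refine ⟨hBs, fun h => ?_⟩
    have h1 := re_inner_adjoint_prod_self_nonneg hT (hB h)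
    rw [inner_sub_left, Complex.sub_re, sub_nonneg] at h1
    have h2 : 0 ≤ (inner ℂ (B h) (B h)).re := inner_self_nonneg (𝕜 := ℂ)
    have h3 := inner_re_symm (𝕜 := ℂ) h (B h)
    exact (h2.trans h1).trans_eq h3
  have hB1 : 0 ≤ 1 - B := by
    rw [ContinuousLinearMap.nonneg_iff_isPositive, ContinuousLinearMap.isPositive_def']
    refine ⟨(IsSelfAdjoint.one _).sub hBs, fun h => ?_⟩
    have h1 := re_inner_adjoint_prod_self_nonneg hT (hB h)
    have h2 : 0 ≤ (inner ℂ (h - B h) (h - B h)).re := inner_self_nonneg (𝕜 := ℂ)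
    rw [inner_sub_right, Complex.sub_re] at h2
    exact h1.trans (sub_nonneg.1 h2)
  set R := CFC.sqrt B with hRdef
  set Q := CFC.sqrt (1 - B) with hQdef
  have hRR : R * R = B := CFC.sqrt_mul_sqrt_self B hB0
  have hQQ : Q * Q = 1 - B := CFC.sqrt_mul_sqrt_self _ hB1
  have hsum : R * R + Q * Q = 1 := by rw [hRR, hQQ, add_sub_cancel]
  have hRQ : Commute R Q := by
    have h1 : Commute R (1 - B) :=
      Commute.cfcₙ_nnreal ((Commute.one_right B).sub_right (Commute.refl B)) _
    exact (Commute.cfcₙ_nnreal h1.symm _).symm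
  have hRB : ∀ x, R (R x) = B x := fun x => DFunLike.congr_fun hRR x
  have hR : Function.Injective R := by
    rw [injective_iff_map_eq_zero]
    intro h hh
    have hBh : B h = 0 := by rw [← hRB, hh, map_zero]
    have := hB h
    rw [hBh, sub_zero] at this
    exact LinearPMap.graph_fst_eq_zero_snd _ this rfl
  refine ⟨divide Q R hR, isPositive_divide (CFC.sqrt_nonneg _) (CFC.sqrt_nonneg _) hRQ hsum,
    LinearPMap.eq_of_eq_graph ?_⟩
  ext ⟨x, y⟩
  rw [mem_graph_divide_prod_self hRQ hsum, hRB]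
  constructor
  · intro h
    have := hB (x + y)
    rwa [h, add_sub_cancel_left] at this
  · intro h
    -- 1 + T*T is injective: the two graph points differ by (d, -d), and positivity forces d = 0.
    have h1 := (prod T† T).graph.sub_mem (hB (x + y)) h
    set d := B (x + y) - x with hd
    have h2 : (d, -d) ∈ (prod T† T).graph := by
      convert h1 using 1
      ext
      · rfl
      · simp only [hd, Prod.snd_sub]
        abel
    have h3 := re_inner_adjoint_prod_self_nonneg hT h2
    have h4 : ‖d‖ ^ 2 = (inner ℂ d d).re := norm_sq_eq_re_inner (𝕜 := ℂ) _
    rw [inner_neg_left, Complex.neg_re, ← h4] at h3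
    have h5 : d = 0 := by
      rw [← norm_eq_zero, ← sq_eq_zero_iff]
      nlinarith [sq_nonneg ‖d‖]
    exact sub_eq_zero.1 h5

theorem modulus_spec {T : E →ₗ.[ℂ] F} (hT : Dense (T.domain : Set E)) (hc : T.IsClosed) :
    IsPositive (modulus T) ∧ prod (modulus T) (modulus T) = prod T† T := by
  have h := exists_sqrt_adjoint_prod_self hT hc
  rw [modulus, sqrt, dif_pos h]
  exact h.choose_spec

end SquareRoot

end UnboundedOperator

namespace UnboundedOperator

/-! ### Minimizers as eigenvectors, and the equivalence -/

section MinimumAttaining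

variable {E F : Type*} [NormedAddCommGroup E] [InnerProductSpace ℂ E] [CompleteSpace E]
  [NormedAddCommGroup F] [InnerProductSpace ℂ F] {T : E →ₗ.[ℂ] F}

/-- A minimizer of `‖T x‖` on the unit sphere is an eigenvector of `T* T`. -/
theorem mem_graph_adjoint_prod_self_of_minimizer (hT : Dense (T.domain : Set E)) {x₀ : E} {y₀ : F}
    (h₀ : (x₀, y₀) ∈ T.graph) (hx₀ : ‖x₀‖ = 1)
    (hmin : ∀ x y, (x, y) ∈ T.graph → ‖y₀‖ * ‖x‖ ≤ ‖y‖) :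
    (x₀, ((‖y₀‖ ^ 2 : ℝ) : ℂ) • x₀) ∈ (prod T† T).graph := by
  refine mem_graph_prod.2 ⟨y₀, h₀, (mem_graph_adjoint hT).2 fun x y hxy => ?_⟩
  rw [inner_smul_left, Complex.conj_ofReal]
  set m := ‖y₀‖ with hm
  set β : ℂ := inner ℂ y₀ y - ((m ^ 2 : ℝ) : ℂ) * inner ℂ x₀ x with hβ
  set q : ℝ := ‖y‖ ^ 2 - m ^ 2 * ‖x‖ ^ 2 with hq
  have hq0 : 0 ≤ q := by
    have := pow_le_pow_left₀ (by positivity) (hmin x y hxy) 2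
    rw [hq]
    linarith [mul_pow m ‖x‖ 2]
  have hvar : ∀ s : ℝ, 0 ≤ -(2 * s * ‖β‖ ^ 2) + s ^ 2 * ‖β‖ ^ 2 * q := by
    intro s
    -- Perturbing x₀ by c x changes ‖T·‖² - m²‖·‖² by 2 Re(cβ) + |c|² q; this c makes cβ = -s|β|².
    set c : ℂ := -(s : ℂ) * (starRingEnd ℂ) β with hcdef
    have hmem := T.graph.add_mem h₀ (T.graph.smul_mem c hxy)
    have h1 := pow_le_pow_left₀ (by positivity) (hmin (x₀ + c • x) (y₀ + c • y) hmem) 2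
    rw [mul_pow, norm_add_sq (𝕜 := ℂ), norm_add_sq (𝕜 := ℂ), norm_smul, norm_smul,
      inner_smul_right, inner_smul_right, hx₀, ← hm] at h1
    have hc2 : ‖c‖ ^ 2 = s ^ 2 * ‖β‖ ^ 2 := by
      rw [hcdef, norm_mul, norm_neg, Complex.norm_real, RCLike.norm_conj, mul_pow,
        Real.norm_eq_abs, sq_abs]
    have hre : (c * inner ℂ y₀ y).re - m ^ 2 * (c * inner ℂ x₀ x).re = -(s * ‖β‖ ^ 2) := by
      have h2 : c * inner ℂ y₀ y - ((m ^ 2 : ℝ) : ℂ) * (c * inner ℂ x₀ x)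
          = ((-(s * ‖β‖ ^ 2) : ℝ) : ℂ) := by
        have h3 : (starRingEnd ℂ) β * β = ((‖β‖ ^ 2 : ℝ) : ℂ) := by
          rw [Complex.conj_mul']
          push_cast
          rfl
        push_cast at h3 ⊢
        rw [← h3, hcdef, hβ]
        push_cast
        ring
      have h4 := congrArg Complex.re h2
      rwa [Complex.sub_re, Complex.re_ofReal_mul, Complex.ofReal_re] at h4
    simp only [RCLike.re_to_complex] at h1
    rw [mul_pow ‖c‖ ‖x‖, mul_pow ‖c‖ ‖y‖, hc2] at h1
    rw [hq]
    linear_combination h1 + 2 * hre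
  have hpos : 0 < q + 1 := by linarith
  -- With s = 1/(q + 1) one has sq < 2, even when q = 0, so the bound is negative unless β = 0.
  have h1 := hvar (1 / (q + 1))
  have h2 : -(2 * (1 / (q + 1)) * ‖β‖ ^ 2) + (1 / (q + 1)) ^ 2 * ‖β‖ ^ 2 * q
      = -(‖β‖ ^ 2 * ((q + 2) / (q + 1) ^ 2)) := by
    field_simp
    ring
  rw [h2] at h1
  have h3 : 0 < (q + 2) / (q + 1) ^ 2 := by positivity
  have h4 : ‖β‖ ^ 2 = 0 := by nlinarith [sq_nonneg ‖β‖]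
  have h5 : β = 0 := by simpa using h4
  exact (sub_eq_zero.1 h5).symm

/-- A self-adjoint operator that is bounded below is surjective. -/
theorem exists_mem_graph_of_bounded_below {A : E →ₗ.[ℂ] E} (hA : IsSelfAdjoint A) {c : ℝ}
    (hc : 0 < c) (hbd : ∀ x y, (x, y) ∈ A.graph → c * ‖x‖ ≤ ‖y‖) (y : E) :
    ∃ x, (x, y) ∈ A.graph := by
  let f : A.graph →L[ℂ] E := ContinuousLinearMap.snd ℂ E E ∘L A.graph.subtypeL
  have hcomp : CompleteSpace A.graph := hA.isClosed.completeSpace_coe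
  have hf : AntilipschitzWith (Real.toNNReal (max c⁻¹ 1)) f := by
    refine f.antilipschitz_of_bound fun ⟨⟨x, y⟩, hxy⟩ => ?_
    rw [Real.coe_toNNReal _ (le_max_of_le_right zero_le_one)]
    change max ‖x‖ ‖y‖ ≤ max c⁻¹ 1 * ‖y‖
    have h1 : ‖x‖ ≤ c⁻¹ * ‖y‖ := by
      rw [inv_mul_eq_div, le_div_iff₀ hc, mul_comm]
      exact hbd x y hxy
    refine max_le (h1.trans ?_) ?_
    · exact mul_le_mul_of_nonneg_right (le_max_left _ _) (norm_nonneg _)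
    · exact le_mul_of_one_le_left (norm_nonneg _) (le_max_right _ _)
  have hclosed : IsClosed (LinearMap.range (f : A.graph →ₗ[ℂ] E) : Set E) := by
    rw [LinearMap.coe_range]
    exact hf.isClosed_range f.uniformContinuous
  have hsa := LinearPMap.isSelfAdjoint_def.1 hA
  have hdense : (LinearMap.range (f : A.graph →ₗ[ℂ] E)).topologicalClosure = ⊤ := by
    rw [Submodule.topologicalClosure_eq_top_iff, Submodule.eq_bot_iff]
    intro z hz
    -- A vector orthogonal to the range lies in ker A* = ker A, which the lower bound makes trivial.
    have hz0 : (z, 0) ∈ A.graph := by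
      rw [← hsa, mem_graph_adjoint hA.dense_domain]
      intro x y hxy
      rw [inner_zero_left]
      exact ((Submodule.mem_orthogonal' _ _).1 hz y ⟨⟨(x, y), hxy⟩, rfl⟩).symm
    have := hbd z 0 hz0
    rw [norm_zero] at this
    exact norm_le_zero_iff.1 (by nlinarith [norm_nonneg z])
  rw [hclosed.submodule_topologicalClosure_eq] at hdense
  obtain ⟨⟨⟨x, y'⟩, hxy⟩, rfl⟩ := (hdense ▸ Submodule.mem_top : y ∈ LinearMap.range _)
  exact ⟨x, hxy⟩

/-- A minimizer of `‖A x‖` on the unit sphere, for `A` positive, is an eigenvector of `A`. -/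
theorem IsPositive.eq_smul_of_minimizer {A : E →ₗ.[ℂ] E} (hA : IsPositive A) {x₀ y₀ : E}
    (h₀ : (x₀, y₀) ∈ A.graph) (hx₀ : ‖x₀‖ = 1)
    (hmin : ∀ x y, (x, y) ∈ A.graph → ‖y₀‖ * ‖x‖ ≤ ‖y‖) : y₀ = (‖y₀‖ : ℂ) • x₀ := by
  rcases eq_or_ne y₀ 0 with h | h
  · simp [h]
  have hsq := mem_graph_adjoint_prod_self_of_minimizer hA.isSelfAdjoint.dense_domain h₀ hx₀ hmin
  rw [LinearPMap.isSelfAdjoint_def.1 hA.isSelfAdjoint] at hsq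
  obtain ⟨y, hy, hyz⟩ := mem_graph_prod.1 hsq
  obtain rfl : y = y₀ := A.mem_graph_snd_inj hy h₀ rfl
  have hpos : 0 < ‖y‖ := norm_pos_iff.2 h
  -- With m = ‖y‖, (A + m)(A - m)x₀ = 0, so w = (A - m)x₀ satisfies Aw = -mw; as m > 0, positivity
  -- gives w = 0.
  set w := y - (‖y‖ : ℂ) • x₀ with hw
  have hmem : (w, -((‖y‖ : ℂ) • w)) ∈ A.graph := by
    convert A.graph.sub_mem hyz (A.graph.smul_mem (‖y‖ : ℂ) h₀) using 1
    ext
    · rfl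
    · simp only [hw, Prod.snd_sub, Prod.smul_snd, smul_sub, smul_smul, neg_sub]
      push_cast
      rw [sq]
  obtain ⟨u, hu, hAu⟩ := A.mem_graph_iff.1 hmem
  have h1 := hA.nonneg u
  have h4 : ‖w‖ ^ 2 = (inner ℂ w w).re := norm_sq_eq_re_inner (𝕜 := ℂ) _
  dsimp only at hu hAu
  rw [hu, hAu, inner_neg_left, inner_smul_left, Complex.conj_ofReal, Complex.neg_re,
    Complex.re_ofReal_mul, ← h4] at h1
  have h5 : ‖w‖ ^ 2 = 0 := by nlinarith [sq_nonneg ‖w‖]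
  exact sub_eq_zero.1 (norm_eq_zero.1 (sq_eq_zero_iff.1 h5))

/-- For c > 0, surjectivity of A = T*T gives x = Az. With s = Tz, ‖x‖² = ⟨s, t⟩ and ‖s‖² = ⟨x, z⟩ ≤
‖x‖²/c; Cauchy–Schwarz on the first combines them. This also reaches those x in D(T) outside D(A).
-/
theorem bounded_below_of_adjoint_prod_self [CompleteSpace F] (hT : Dense (T.domain : Set E))
    (hc : T.IsClosed) {c : ℝ} (hc0 : 0 ≤ c)
    (hbd : ∀ x y, (x, y) ∈ (prod T† T).graph → c * ‖x‖ ≤ ‖y‖) {x : E} {t : F}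
    (hxt : (x, t) ∈ T.graph) : c * ‖x‖ ^ 2 ≤ ‖t‖ ^ 2 := by
  rcases hc0.eq_or_lt with rfl | hpos
  · simp
  obtain ⟨z, hz⟩ := exists_mem_graph_of_bounded_below
    (isPositive_adjoint_prod_self hT hc).isSelfAdjoint hpos hbd x
  obtain ⟨s, hs, -⟩ := mem_graph_prod.1 hz
  have h1 : ‖x‖ ^ 2 ≤ ‖s‖ * ‖t‖ := by
    have h := inner_adjoint_prod_self hT hz hs hxt
    have h' : ‖x‖ ^ 2 = (inner ℂ x x).re := norm_sq_eq_re_inner (𝕜 := ℂ) _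
    rw [h', h]
    exact re_inner_le_norm (𝕜 := ℂ) s t
  have h2 : ‖s‖ ^ 2 ≤ ‖x‖ * ‖z‖ := by
    have h := inner_adjoint_prod_self hT hz hs hs
    have h' : ‖s‖ ^ 2 = (inner ℂ s s).re := norm_sq_eq_re_inner (𝕜 := ℂ) _
    rw [h', ← h]
    exact re_inner_le_norm (𝕜 := ℂ) x z
  have h3 : c * ‖z‖ ≤ ‖x‖ := hbd z x hz
  have h4 : c * ‖s‖ ^ 2 ≤ ‖x‖ ^ 2 := by
    nlinarith [mul_le_mul_of_nonneg_left h3 (norm_nonneg x)]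
  rcases (norm_nonneg x).eq_or_lt with hx | hx
  · rw [← hx, zero_pow two_ne_zero, mul_zero]
    positivity
  have h5 : (‖x‖ ^ 2) ^ 2 ≤ ‖s‖ ^ 2 * ‖t‖ ^ 2 := by
    rw [← mul_pow]
    exact pow_le_pow_left₀ (by positivity) h1 2
  have h6 : ‖x‖ ^ 2 * (c * ‖x‖ ^ 2) ≤ ‖x‖ ^ 2 * ‖t‖ ^ 2 := by
    nlinarith [mul_le_mul_of_nonneg_left h5 hc0,
      mul_le_mul_of_nonneg_right h4 (sq_nonneg ‖t‖)]
  exact le_of_mul_le_mul_left h6 (by positivity)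

theorem isMinimumAttaining_iff_adjoint_prod_self [CompleteSpace F]
    (hT : Dense (T.domain : Set E)) (hc : T.IsClosed) :
    IsMinimumAttaining T ↔ IsMinimumAttaining (prod T† T) := by
  have hA := isPositive_adjoint_prod_self hT hc
  constructor
  · rintro ⟨-, -, h⟩
    refine ⟨hA.isSelfAdjoint.dense_domain, hA.isSelfAdjoint.isClosed, attains_iff.2 ?_⟩
    obtain ⟨x₀, y₀, h₀, hx₀, hmin⟩ := attains_iff.1 h
    refine ⟨x₀, _, mem_graph_adjoint_prod_self_of_minimizer hT h₀ hx₀ hmin, hx₀, fun x y hxy => ?_⟩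
    rw [norm_smul, hx₀, mul_one, Complex.norm_real, Real.norm_of_nonneg (sq_nonneg _)]
    obtain ⟨t, ht, -⟩ := mem_graph_prod.1 hxy
    rcases (norm_nonneg x).eq_or_lt with hx | hx
    · rw [← hx, mul_zero]
      exact norm_nonneg y
    have h1 : ‖t‖ ^ 2 ≤ ‖y‖ * ‖x‖ := by
      have h' : ‖t‖ ^ 2 = (inner ℂ t t).re := norm_sq_eq_re_inner (𝕜 := ℂ) _
      rw [h', ← inner_adjoint_prod_self hT hxy ht ht]
      exact re_inner_le_norm (𝕜 := ℂ) y x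
    have h2 := pow_le_pow_left₀ (by positivity) (hmin x t ht) 2
    refine le_of_mul_le_mul_right ?_ hx
    calc ‖y₀‖ ^ 2 * ‖x‖ * ‖x‖ = (‖y₀‖ * ‖x‖) ^ 2 := by ring
      _ ≤ ‖y‖ * ‖x‖ := h2.trans h1
  · rintro ⟨-, -, h⟩
    refine ⟨hT, hc, attains_iff.2 ?_⟩
    obtain ⟨x₀, y₀, h₀, hx₀, hmin⟩ := attains_iff.1 h
    obtain ⟨t₀, ht₀, -⟩ := mem_graph_prod.1 h₀
    refine ⟨x₀, t₀, ht₀, hx₀, fun x t hxt => ?_⟩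
    have h1 := bounded_below_of_adjoint_prod_self hT hc (norm_nonneg y₀) hmin hxt
    have h2 : ‖t₀‖ ^ 2 = ‖y₀‖ := by
      have h' : ‖t₀‖ ^ 2 = (inner ℂ t₀ t₀).re := norm_sq_eq_re_inner (𝕜 := ℂ) _
      have h'' : ‖x₀‖ ^ 2 = (inner ℂ x₀ x₀).re := norm_sq_eq_re_inner (𝕜 := ℂ) _
      rw [h', ← inner_adjoint_prod_self hT h₀ ht₀ ht₀,
        congrArg (fun v => (inner ℂ v x₀).re) (hA.eq_smul_of_minimizer h₀ hx₀ hmin),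
        inner_smul_left, Complex.conj_ofReal, Complex.re_ofReal_mul, ← h'', hx₀, one_pow, mul_one]
    refine le_of_sq_le_sq ?_ (norm_nonneg t)
    rwa [mul_pow, h2]

end MinimumAttaining

end UnboundedOperator

theorem theorem3p6 {H₁ H₂ : Type*}
    [NormedAddCommGroup H₁] [InnerProductSpace ℂ H₁] [CompleteSpace H₁]
    [NormedAddCommGroup H₂] [InnerProductSpace ℂ H₂] [CompleteSpace H₂]
    (T : H₁ →ₗ.[ℂ] H₂) (hdense : Dense (T.domain : Set H₁)) (hclosed : T.IsClosed) :
    List.TFAE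
      [UnboundedOperator.IsMinimumAttaining T,
        UnboundedOperator.IsMinimumAttaining (UnboundedOperator.modulus T),
        UnboundedOperator.IsMinimumAttaining (UnboundedOperator.prod T† T)] := by
  obtain ⟨hpos, hsq⟩ := UnboundedOperator.modulus_spec hdense hclosed
  have hS := UnboundedOperator.isMinimumAttaining_iff_adjoint_prod_self
    hpos.isSelfAdjoint.dense_domain hpos.isSelfAdjoint.isClosed
  -- Self-adjointness of |T| turns |T|*|T| into |T|² = T*T.
  rw [LinearPMap.isSelfAdjoint_def.1 hpos.isSelfAdjoint, hsq] at hS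
  tfae_have 1 ↔ 3 :=
    UnboundedOperator.isMinimumAttaining_iff_adjoint_prod_self hdense hclosed
  tfae_have 2 ↔ 3 := hS
  tfae_finish
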